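/- All rings are commutative. Let $R$ be a discrete valuation ring with maximal ideal $\mathfrak{p}$ and field of fractions $K$. Let $A$ be an order over $R$: $A$ is an $R$-algebra that is finitely generated and torsion-free as an $R$-module, and its total quotient ring $L=Q(A)=A\otimes_R K$ is a finite étale $K$-algebra, i.e. finite-dimensional over $K$ with non-degenerate trace form $(x,y)\mapsto \mathrm{Tr}_{L/K}(xy)$. Let $\overline{A}$ be the integral closure of $A$ in $L$, let $A^{\dagger}=\{x\in L:\mathrm{Tr}_{L/K}(xA)\subseteq R\}$, let $B=A^{\dagger}/A$ and $I=\mathrm{Ann}_R(B)$. Consider the symmetric $R/I$-bilinear form $$\langle\ ,\ \rangle: B\times B\to I^{-1}/R,\qquad \langle x+A,y+A\rangle=\mathrm{Tr}_{L/K}(xy)+R,$$ write $\mathfrak{m}=\mathfrak{p}(R/I)$, and for a submodule $C\subseteq B$ let $C^{\perp}$ be its orthogonal complement. Let $n$ be the length of $R/I$, and define the radical root and the lower root of $B$ by $$\mathrm{rr}(B)=\bigcap_{C\subseteq B:\ \mathfrak{m}C^{\perp}\subseteq C\subseteq C^{\perp}} C,\qquad \mathrm{lr}(B)=\sum_{k=0}^{n}\bigl(\mathfrak{m}^kB\cap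 B[\mathfrak{m}^k]\bigr),$$ where $B[\mathfrak{m}^k]=\{x\in B:\mathfrak{m}^kx=0\}$. The form is called anisotropic if $\mathrm{lr}(B)$ is the unique submodule $C$ of $B$ with $\mathfrak{m}C^{\perp}\subseteq C\subseteq C^{\perp}$. An order $A'$ over $R$ is called tame at $\mathfrak{p}$ if the radical $\{x: \mathrm{Tr}(xy)=0 \text{ for all } y\}$ of the trace form of the $R/\mathfrak{p}$-algebra $A'/\mathfrak{p}A'$ is equal to the nilradical of $A'/\mathfrak{p}A'$. **Theorem.** Suppose that $\overline{A}$ is tame at $\mathfrak{p}$. Let $A\subseteq D\subseteq A^{\dagger}$ be the $R$-module with $D/A=\mathrm{rr}(B)$, and let $A[D]$ be the smallest subring of $L$ containing $A$ and $D$. Then: 1. $A[D]\subseteq\overline{A}\subseteq A^{\dagger}$ and $\mathrm{rr}(B)=D/A\subseteq A[D]/A\subseteq \overline{A}/A$. 2. If $\langle\ ,\ \rangle$ is anisotropic, then $\overline{A}/A=\mathrm{lr}(B)$. 3. If $\mathfrak{m}\cdot \mathrm{rr}(B)^{\perp}\subseteq \mathrm{rr}(B)$ and $A[D]$ is tame at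 $\mathfrak{p}$, then $\overline{A}/A=A[D]/A$, i.e. $\overline{A}=A[D]$. -/

import Mathlib

namespace TraceOrder

open IsLocalRing

section Forms

variable {S M N : Type*} [CommRing S] [AddCommGroup M] [Module S M] [AddCommGroup N] [Module S N]

/-- The condition `𝔪 L^⊥ ⊆ L ⊆ L^⊥` on a submodule `L` of a module `M` with a symmetric bilinear
form `b : M × M → N`, where `𝔪` is an ideal of the base ring `S`. -/
def IsRootSubmodule (𝔪 : Ideal S) (b : M →ₗ[S] M →ₗ[S] N) (L : Submodule S M) : Prop :=
  𝔪 • L.orthogonalBilin b ≤ L ∧ L ≤ L.orthogonalBilin b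

/-- The radical root: the intersection of all submodules `L` with `𝔪 L^⊥ ⊆ L ⊆ L^⊥`. -/
def radicalRoot (𝔪 : Ideal S) (b : M →ₗ[S] M →ₗ[S] N) : Submodule S M :=
  sInf {L | IsRootSubmodule 𝔪 b L}

variable (M) in
/-- The lower root: `∑_{k = 0}^{n} (𝔪 ^ k M ∩ M[𝔪 ^ k])`, where `n` is the length of the ring `S`
as a module over itself. -/
def lowerRoot (𝔪 : Ideal S) : Submodule S M :=
  ⨆ (k : ℕ) (_ : (k : ℕ∞) ≤ Module.length S S),
    ((𝔪 ^ k) • (⊤ : Submodule S M)) ⊓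
      Submodule.torsionBySet S M ((𝔪 ^ k : Ideal S) : Set S)

/-- The form `b` is anisotropic if the lower root is the unique submodule `L` with
`𝔪 L^⊥ ⊆ L ⊆ L^⊥`. -/
def IsAnisotropic (𝔪 : Ideal S) (b : M →ₗ[S] M →ₗ[S] N) : Prop :=
  ∀ L : Submodule S M, IsRootSubmodule 𝔪 b L ↔ L = lowerRoot M 𝔪

end Forms

section Algebras

/-- A finite algebra `A` over a field `k` is finite étale if its trace form
`(x, y) ↦ Tr_{A/k}(xy)` is non-degenerate. -/
structure IsFiniteEtale (k A : Type*) [Field k] [CommRing A] [Algebra k A] : Prop where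
  finite : Module.Finite k A
  nondegenerate : (Algebra.traceForm k A).Nondegenerate

/-- A finite algebra `A` over a field `k` is tame if the radical
`{x | Tr_{A/k}(xA) = 0}` of its trace form is the nilradical of `A`.
(Here `k` is only a commutative ring in Lean, so that the definition applies to `R ⧸ p` for a
maximal ideal `p` as it stands.) -/
def IsTame (k A : Type*) [CommRing k] [CommRing A] [Algebra k A] : Prop :=
  ∀ x : A, (∀ y : A, Algebra.trace k A (x * y) = 0) ↔ x ∈ nilradical A

/-- The `R`-algebra `A` is tame at the prime `p` of `R` if `A / pA` is tame over `R / p`. -/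
def IsTameAt {R : Type*} [CommRing R] (p : Ideal R) (A : Type*) [CommRing A] [Algebra R A] :
    Prop :=
  IsTame (R ⧸ p) (A ⧸ p.map (algebraMap R A))

end Algebras

section Orders

variable (R A K L : Type*) [CommRing R] [CommRing A] [Algebra R A]
  [Field K] [Algebra R K] [CommRing L] [Algebra A L] [Algebra R L]
  [IsScalarTower R A L] [Algebra K L] [IsScalarTower R K L]

/-- `A` is an order over the domain `R` with field of fractions `K`: it is finitely
generated and torsion-free as an `R`-module, and its total quotient ring `L` (that is, `L` satisfies
`IsFractionRing A L`) is a finite étale `K`-algebra. -/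
structure IsOrder [IsFractionRing R K] [IsFractionRing A L] : Prop where
  finite : Module.Finite R A
  torsionFree : Module.IsTorsionFree R A
  finiteEtale : IsFiniteEtale K L

/-- The order `A` as an `R`-submodule of its total quotient ring `L`. -/
abbrev orderSubmodule : Submodule R L :=
  LinearMap.range (IsScalarTower.toAlgHom R A L).toLinearMap

/-- The trace dual `A^† = {x ∈ L | Tr_{L/K}(xA) ⊆ R}`. -/
noncomputable abbrev traceDual : Submodule R L :=
  (Algebra.traceForm K L).dualSubmodule (orderSubmodule R A L)

/-- The `R`-module `B = A^† / A`. (For an order, `A` is contained in `A^†`.) -/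
noncomputable abbrev TraceQuotient : Type _ :=
  traceDual R A K L ⧸ (orderSubmodule R A L).submoduleOf (traceDual R A K L)

/-- The ideal `I = Ann_R(A^† / A)`. -/
noncomputable abbrev traceAnn : Ideal R := Module.annihilator R (TraceQuotient R A K L)

/-- `A^† / A` is a module over `R / I`. -/
noncomputable instance : Module (R ⧸ traceAnn R A K L) (TraceQuotient R A K L) :=
  Module.quotientAnnihilator

instance : IsScalarTower R (R ⧸ traceAnn R A K L) (TraceQuotient R A K L) :=
  ⟨fun r s b => by
    obtain ⟨s, rfl⟩ := Ideal.Quotient.mk_surjective s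
    exact mul_smul r s b⟩

variable {R} in
/-- The inverse `I⁻¹ = {z ∈ K | I z ⊆ R}` of an ideal `I` of `R`. -/
def invIdeal (I : Ideal R) : Submodule R K where
  carrier := {z | ∀ a ∈ I, a • z ∈ (1 : Submodule R K)}
  add_mem' hx hy a ha := by rw [smul_add]; exact add_mem (hx a ha) (hy a ha)
  zero_mem' a _ := by rw [smul_zero]; exact zero_mem _
  smul_mem' r x hx a ha := by
    rw [smul_comm]; exact Submodule.smul_mem _ r (hx a ha)

variable {R} in
/-- The `R`-module `I⁻¹ / R`. -/
abbrev InvQuotient (I : Ideal R) : Type _ :=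
  invIdeal K I ⧸ (1 : Submodule R K).submoduleOf (invIdeal K I)

variable {R} in
theorem isTorsionBySet_invQuotient (I : Ideal R) :
    Module.IsTorsionBySet R (InvQuotient K I) (I : Set R) := by
  rintro z ⟨a, ha⟩
  obtain ⟨z, rfl⟩ := Submodule.Quotient.mk_surjective _ z
  exact (Submodule.Quotient.mk_eq_zero _).2 (z.2 a ha)

variable {R} in
/-- `I⁻¹ / R` is a module over `R / I`. -/
noncomputable instance (I : Ideal R) : Module (R ⧸ I) (InvQuotient K I) :=
  (isTorsionBySet_invQuotient K I).module

variable {R A K L} in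
theorem trace_mul_mem_one {x y : L} (hx : x ∈ traceDual R A K L) (hy : y ∈ orderSubmodule R A L) :
    Algebra.trace K L (x * y) ∈ (1 : Submodule R K) := by
  simpa [Algebra.traceForm_apply] using hx y hy

variable {R A K L} in
theorem smul_mem_order {a : R} (ha : a ∈ traceAnn R A K L) (x : traceDual R A K L) :
    a • (x : L) ∈ orderSubmodule R A L := by
  have h := Module.mem_annihilator.1 ha (Submodule.Quotient.mk x)
  rw [← Submodule.Quotient.mk_smul, Submodule.Quotient.mk_eq_zero] at h
  exact h

variable {R A K L} in
theorem trace_mul_mem_inv (x y : traceDual R A K L) :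
    Algebra.trace K L ((x : L) * y) ∈ invIdeal K (traceAnn R A K L) := by
  intro a ha
  have h := trace_mul_mem_one y.2 (smul_mem_order ha x)
  rwa [mul_smul_comm, mul_comm, ← algebraMap_smul K a ((x : L) * y), map_smul, algebraMap_smul]
    at h

/-- The map `A^† × A^† → I⁻¹ / R`, `(x, y) ↦ Tr_{L/K}(xy) + R`. -/
noncomputable def tracePairing :
    traceDual R A K L →ₗ[R] traceDual R A K L →ₗ[R] InvQuotient K (traceAnn R A K L) :=
  LinearMap.mk₂ R
    (fun x y => Submodule.Quotient.mk ⟨Algebra.trace K L ((x : L) * y), trace_mul_mem_inv x y⟩)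
    (fun x x' y => by
      rw [← Submodule.Quotient.mk_add]; congr 1; ext; simp [add_mul])
    (fun c x y => by
      rw [← Submodule.Quotient.mk_smul]; congr 1; ext
      simp only [Submodule.coe_smul, smul_mul_assoc]
      rw [← algebraMap_smul K c ((x : L) * y), map_smul, algebraMap_smul])
    (fun x y y' => by
      rw [← Submodule.Quotient.mk_add]; congr 1; ext; simp [mul_add])
    (fun c x y => by
      rw [← Submodule.Quotient.mk_smul]; congr 1; ext
      simp only [Submodule.coe_smul, mul_smul_comm]
      rw [← algebraMap_smul K c ((x : L) * y), map_smul, algebraMap_smul])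

variable {R A K L} in
theorem tracePairing_eq_zero_left (x y : traceDual R A K L) (hx : (x : L) ∈ orderSubmodule R A L) :
    tracePairing R A K L x y = 0 := by
  refine (Submodule.Quotient.mk_eq_zero _).2 ?_
  have h := trace_mul_mem_one y.2 hx
  rw [mul_comm] at h
  exact h

variable {R A K L} in
theorem tracePairing_eq_zero_right (x y : traceDual R A K L)
    (hy : (y : L) ∈ orderSubmodule R A L) :
    tracePairing R A K L x y = 0 :=
  (Submodule.Quotient.mk_eq_zero _).2 (trace_mul_mem_one x.2 hy)

/-- The `R`-bilinear form on `A^† / A` induced by `tracePairing`. -/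
noncomputable def traceQuotientPairing :
    TraceQuotient R A K L →ₗ[R] TraceQuotient R A K L →ₗ[R]
      InvQuotient K (traceAnn R A K L) :=
  Submodule.liftQ _
    (LinearMap.flip (Submodule.liftQ _ (tracePairing R A K L).flip fun y hy => by
      ext x
      exact tracePairing_eq_zero_right x y hy))
    fun x hx => by
      ext y
      exact tracePairing_eq_zero_left x y hx

/-- The symmetric `R / I`-bilinear form
`A^† / A × A^† / A → I⁻¹ / R`, `(x + A, y + A) ↦ Tr_{L/K}(xy) + R`. -/
noncomputable def traceQuotientForm :
    TraceQuotient R A K L →ₗ[R ⧸ traceAnn R A K L] TraceQuotient R A K L →ₗ[R ⧸ traceAnn R A K L]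
      InvQuotient K (traceAnn R A K L) :=
  LinearMap.mk₂ (R ⧸ traceAnn R A K L) (fun x y => traceQuotientPairing R A K L x y)
    (fun x x' y => by simp)
    (fun c x y => by
      obtain ⟨c, rfl⟩ := Ideal.Quotient.mk_surjective c
      exact LinearMap.map_smul₂ (traceQuotientPairing R A K L) c x y)
    (fun x y y' => by simp)
    (fun c x y => by
      obtain ⟨c, rfl⟩ := Ideal.Quotient.mk_surjective c
      exact map_smul (traceQuotientPairing R A K L x) c y)

theorem traceQuotientForm_mk (x y : traceDual R A K L) :
    traceQuotientForm R A K L (Submodule.Quotient.mk x) (Submodule.Quotient.mk y) =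
      Submodule.Quotient.mk ⟨Algebra.trace K L ((x : L) * y), trace_mul_mem_inv x y⟩ :=
  rfl

variable {R L} in
/-- For an `R`-submodule `P` of `L` with `A ⊆ P ⊆ A^†`, the submodule `P / A` of `A^† / A`. -/
def quotientSubmodule (P : Submodule R L) :
    Submodule (R ⧸ traceAnn R A K L) (TraceQuotient R A K L) where
  carrier := {b | ∃ x : traceDual R A K L, (x : L) ∈ P ∧ Submodule.Quotient.mk x = b}
  add_mem' := by
    rintro _ _ ⟨x, hx, rfl⟩ ⟨y, hy, rfl⟩
    exact ⟨x + y, add_mem hx hy, rfl⟩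
  zero_mem' := ⟨0, zero_mem P, rfl⟩
  smul_mem' := by
    rintro c _ ⟨x, hx, rfl⟩
    obtain ⟨c, rfl⟩ := Ideal.Quotient.mk_surjective c
    exact ⟨c • x, P.smul_mem c hx, rfl⟩

variable {A L} in
/-- An `A`-subalgebra of `L`, as an `R`-submodule of `L`. -/
abbrev subalgebraSubmodule (T : Subalgebra A L) : Submodule R L :=
  (Subalgebra.toSubmodule T).restrictScalars R

end Orders

end TraceOrder

/-!
Let `𝔭` be the maximal ideal of `R`. For an order `T` between `A` and `Ō`, an element of `T` lies in
`𝔭 T^†` iff its products with `T` all have trace in `𝔭`. Elements of `T` that are nilpotent modulo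
`𝔭` always have this property, so `rad(𝔭 T) ⊆ T ∩ 𝔭 T^†`, and tameness of `T` is the reverse
inclusion.

* If `Ō` is tame, the integral elements of `N = 𝔭 Ō^†` thus lie in `J = rad(𝔭 Ō)`. As `J ^ m N ⊆ Ō`
  for some `m`, and `J N' ⊆ Ō` forces `N' ⊆ Ō` for each `N' = J ^ i N` because `Ō` is integrally
  closed, we get `𝔭 Ō^† ⊆ Ō`. So `Ō / A` satisfies `𝔪 C^⊥ ⊆ C ⊆ C^⊥`: it contains `rr(B)`, and it is
  `lr(B)` if the form is anisotropic.
* If `T = A[D]` is tame and `𝔪 rr(B)^⊥ ⊆ rr(B)`, then `𝔭 T^† ⊆ 𝔭 D^† ⊆ D ⊆ T`, so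
  `𝔭 T^† ⊆ rad(𝔭 T) ⊆ rad(𝔭 Ō) ⊆ 𝔭 Ō^†`. Hence `T^† ⊆ Ō^†`, and dualizing gives `Ō ⊆ T`.
-/

namespace TraceOrder

open IsLocalRing Module
open scoped nonZeroDivisors Pointwise

section IntegrallyClosed

variable {O L : Type*} [CommRing O] [CommRing L] [Algebra O L]

-- `isIntegral_of_smul_mem_submodule` needs a domain, while `L` will only be a product of fields.
theorem isIntegral_of_forall_mul_mem {M : Submodule O L} (hM : M.FG) {u : L} (hu : u ∈ M)
    (hu' : IsUnit u) {x : L} (hx : ∀ y ∈ M, x * y ∈ M) : IsIntegral O x := by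
  have : Module.Finite O M := Module.Finite.iff_fg.2 hM
  let f : Module.End O M := (LinearMap.mulLeft O x).restrict hx
  have coe_aeval (q : Polynomial O) (y : M) :
      (Polynomial.aeval f q y : L) = Polynomial.aeval x q * y := by
    induction q using Polynomial.induction_on generalizing y with
    | C a => simp [Algebra.smul_def]
    | add q r hq hr => simp [hq, hr, add_mul]
    | monomial n a ih =>
      rw [pow_succ, ← mul_assoc, map_mul (Polynomial.aeval f), map_mul (Polynomial.aeval x),
        Polynomial.aeval_X, Polynomial.aeval_X, Module.End.mul_apply, ih, mul_assoc]
      rfl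
  obtain ⟨q, hq, hqf⟩ := Module.End.isIntegral.isIntegral (R := O) f
  refine ⟨q, hq, hu'.mul_left_eq_zero.1 ?_⟩
  have hqf' : Polynomial.aeval f q = 0 := hqf
  rw [← Polynomial.aeval_def, ← coe_aeval q ⟨u, hu⟩, hqf', LinearMap.zero_apply,
    Submodule.coe_zero]

variable [IsIntegrallyClosedIn O L] {J : Ideal O} {N : Submodule O L}

-- For `x ∈ N` we have `x J ⊆ J N ⊆ O`, so `x J ⊆ N ∩ O ⊆ J` and `x` is integral.
theorem le_one_of_smul_le_one (hJ : J.FG) (hu : ∃ u ∈ J, IsUnit (algebraMap O L u))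
    (hNJ : N.comap (Algebra.linearMap O L) ≤ J) (hN : J • N ≤ 1) : N ≤ 1 := by
  intro x hx
  obtain ⟨u, huJ, hu⟩ := hu
  have hxJ : ∀ y ∈ Submodule.map (Algebra.linearMap O L) J,
      x * y ∈ Submodule.map (Algebra.linearMap O L) J := by
    rintro _ ⟨j, hj, rfl⟩
    have hxj : x * algebraMap O L j = j • x := by rw [Algebra.smul_def, mul_comm]
    obtain ⟨a, ha⟩ := Submodule.mem_one.1 (hN (Submodule.smul_mem_smul hj hx))
    refine ⟨a, hNJ ?_, ha.trans hxj.symm⟩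
    rw [Submodule.mem_comap, Algebra.linearMap_apply, ha]
    exact N.smul_mem j hx
  have hint : IsIntegral O x :=
    isIntegral_of_forall_mul_mem (Submodule.FG.map _ hJ) (Submodule.mem_map_of_mem huJ) hu hxJ
  exact Submodule.mem_one.2 (IsIntegrallyClosedIn.algebraMap_eq_of_integral hint)

theorem le_one_of_pow_smul_le_one (hJ : J.FG) (hu : ∃ u ∈ J, IsUnit (algebraMap O L u))
    (hNJ : N.comap (Algebra.linearMap O L) ≤ J) {m : ℕ} (hN : J ^ m • N ≤ 1) : N ≤ 1 := by
  induction m generalizing N with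
  | zero => simpa using hN
  | succ m ih =>
    refine le_one_of_smul_le_one hJ hu hNJ (ih ?_ ?_)
    · exact (Submodule.comap_mono Submodule.smul_le_right).trans hNJ
    · rwa [← mul_smul, ← pow_succ]

end IntegrallyClosed

section DualSubmodule

variable {R K V : Type*} [CommRing R] [Field K] [Algebra R K]
  [AddCommGroup V] [Module R V] [Module K V] [IsScalarTower R K V]
  {B : LinearMap.BilinForm K V} {P Q : Submodule R V}

theorem dualSubmodule_anti (h : P ≤ Q) : B.dualSubmodule Q ≤ B.dualSubmodule P :=
  fun _ hx _ hy => hx _ (h hy)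

theorem le_dualSubmodule_comm (hB : B.IsSymm) :
    P ≤ B.dualSubmodule Q ↔ Q ≤ B.dualSubmodule P := by
  have hflip : B.flip = B := LinearMap.BilinForm.isSymm_iff_flip.1 hB
  rw [← LinearMap.BilinForm.le_flip_dualSubmodule, hflip]

end DualSubmodule

section Lattices

variable {R K V : Type*} [CommRing R] [IsDomain R] [IsPrincipalIdealRing R]
  [AddCommGroup V] [Module R V]

theorem le_of_ideal_smul_le_smul [IsTorsionFree R V] {p : Ideal R} (hp : p ≠ ⊥)
    {M N : Submodule R V} (h : p • M ≤ p • N) : M ≤ N := by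
  obtain ⟨π, rfl⟩ := (IsPrincipalIdealRing.principal p).principal
  have hπ : π ≠ 0 := by simpa using hp
  intro x hx
  obtain ⟨y, hy, hxy⟩ : π • x ∈ π • N := by
    rw [← Submodule.ideal_span_singleton_smul]
    exact h (Submodule.smul_mem_smul (Submodule.mem_span_singleton_self π) hx)
  rwa [← smul_right_injective V hπ hxy]

variable [Field K] [Algebra R K] [IsFractionRing R K] [Module K V] [IsScalarTower R K V]

theorem exists_basis_span_eq (P : Submodule R V) [P.IsLattice K] :
    ∃ (n : ℕ) (b : Basis (Fin n) K V), Submodule.span R (Set.range b) = P := by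
  let b := finBasis R P
  have hb : Set.range (b.extendOfIsLattice K) = P.subtype '' Set.range b := by
    rw [← Set.range_comp]
    exact congrArg Set.range (funext fun i => b.extendOfIsLattice_apply K i)
  refine ⟨_, b.extendOfIsLattice K, ?_⟩
  rw [hb, ← Submodule.map_span, b.span_eq, Submodule.map_top, Submodule.range_subtype]

variable {B : LinearMap.BilinForm K V}

theorem fg_dualSubmodule (hB : B.Nondegenerate) (P : Submodule R V) [P.IsLattice K] :
    (B.dualSubmodule P).FG := by
  classical
  obtain ⟨n, b, rfl⟩ := exists_basis_span_eq (K := K) P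
  rw [LinearMap.BilinForm.dualSubmodule_span_of_basis B hB]
  exact Submodule.fg_span (Set.finite_range _)

theorem dualSubmodule_dualSubmodule (hB : B.Nondegenerate) (hB' : B.IsSymm) (P : Submodule R V)
    [P.IsLattice K] : B.dualSubmodule (B.dualSubmodule P) = P := by
  obtain ⟨n, b, rfl⟩ := exists_basis_span_eq (K := K) P
  exact LinearMap.BilinForm.dualSubmodule_dualSubmodule_of_basis B hB hB' b

end Lattices

section Subalgebras

variable {R A L : Type*} [CommRing R] [CommRing A] [Algebra R A] [CommRing L] [Algebra A L]

instance isFractionRing_subalgebra [IsFractionRing A L] (T : Subalgebra A L) :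
    IsFractionRing T L where
  map_units t := by
    obtain ⟨⟨a, s⟩, hts⟩ := IsLocalization.surj A⁰ (t : L)
    have ha : a ∈ A⁰ := by
      refine mem_nonZeroDivisors_iff_right.2 fun b hb => ?_
      have hbt : algebraMap A T (b * s) * t = 0 := Subtype.ext <| by
        change algebraMap A L (b * s) * (t : L) = 0
        rw [map_mul, mul_assoc, mul_comm _ (t : L), hts, ← map_mul, hb, map_zero]
      have hbs : algebraMap A L (b * s) = 0 :=
        congrArg Subtype.val (mem_nonZeroDivisors_iff_right.1 t.2 _ hbt)
      exact mem_nonZeroDivisors_iff_right.1 s.2 _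
        ((IsFractionRing.to_map_eq_zero_iff (K := L)).1 hbs)
    exact isUnit_of_mul_isUnit_left (hts ▸ IsLocalization.map_units L ⟨a, ha⟩)
  surj z := by
    obtain ⟨⟨a, s⟩, hzs⟩ := IsLocalization.surj A⁰ z
    have hs : algebraMap A T s ∈ T⁰ :=
      mem_nonZeroDivisors_of_injective (FaithfulSMul.algebraMap_injective T L)
        (IsLocalization.map_units L s).mem_nonZeroDivisors
    exact ⟨⟨algebraMap A T a, _, hs⟩, hzs⟩
  exists_of_eq h := ⟨1, by rw [FaithfulSMul.algebraMap_injective T L h]⟩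

variable [Algebra R L] [IsScalarTower R A L]

theorem orderSubmodule_subalgebra (T : Subalgebra A L) :
    orderSubmodule R T L = subalgebraSubmodule R T :=
  le_antisymm (by rintro _ ⟨t, rfl⟩; exact t.2) fun x hx => ⟨⟨x, hx⟩, rfl⟩

theorem orderSubmodule_le_subalgebraSubmodule (T : Subalgebra A L) :
    orderSubmodule R A L ≤ subalgebraSubmodule R T := by
  rintro _ ⟨a, rfl⟩
  exact T.algebraMap_mem a

end Subalgebras

section Orders

variable {R A K L : Type*} [CommRing R] [IsDomain R] [CommRing A] [Algebra R A]
  [Field K] [Algebra R K] [IsFractionRing R K] [CommRing L] [Algebra A L] [IsFractionRing A L]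
  [Algebra R L] [IsScalarTower R A L] [Algebra K L]

theorem IsOrder.exists_smul_mem (hA : IsOrder R A K L) (x : L) :
    ∃ r : R, r ≠ 0 ∧ r • x ∈ orderSubmodule R A L := by
  have := hA.finite
  obtain ⟨⟨a, s⟩, hxs⟩ := IsLocalization.surj A⁰ x
  obtain ⟨r, hr, c, hc⟩ :=
    (Algebra.IsIntegral.isIntegral (R := R) (s : A)).isAlgebraic.exists_nonzero_dvd s.2
  refine ⟨r, hr, a * c, ?_⟩
  change algebraMap A L (a * c) = r • x
  rw [map_mul, ← hxs, Algebra.smul_def, IsScalarTower.algebraMap_apply R A L, hc, map_mul]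
  ring

variable [IsScalarTower R K L]

theorem IsFiniteEtale.isOrder (hL : IsFiniteEtale K L) [Module.Finite R A] :
    IsOrder R A K L where
  finite := inferInstance
  torsionFree := by
    have : IsTorsionFree R L := .trans_faithfulSMul R K L
    exact (IsFractionRing.injective A L).moduleIsTorsionFree _ fun r a => by
      simp [Algebra.smul_def, ← IsScalarTower.algebraMap_apply]
  finiteEtale := hL

theorem IsOrder.isLattice (hA : IsOrder R A K L) :
    (orderSubmodule R A L).IsLattice K where
  fg := by
    have := hA.finite
    exact Module.Finite.iff_fg.1 (Module.Finite.range _)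
  span_eq_top := by
    refine eq_top_iff.2 fun x _ => ?_
    obtain ⟨r, hr, hx⟩ := hA.exists_smul_mem x
    have hr' : algebraMap R K r ≠ 0 := by simpa using hr
    rw [← inv_smul_smul₀ hr' x, algebraMap_smul]
    exact Submodule.smul_mem _ _ (Submodule.subset_span hx)

theorem IsOrder.isLocalization (hA : IsOrder R A K L) :
    IsLocalization (Algebra.algebraMapSubmonoid A R⁰) L where
  map_units := by
    rintro ⟨_, r, hr, rfl⟩
    have hr' := (IsLocalization.map_units K ⟨r, hr⟩).map (algebraMap K L)
    rwa [← IsScalarTower.algebraMap_apply, IsScalarTower.algebraMap_apply R A L] at hr'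
  surj z := by
    obtain ⟨r, hr, a, ha⟩ := hA.exists_smul_mem z
    refine ⟨⟨a, _, r, mem_nonZeroDivisors_of_ne_zero hr, rfl⟩, ?_⟩
    rw [mul_comm, ← IsScalarTower.algebraMap_apply R A L, ← Algebra.smul_def]
    exact ha.symm
  exists_of_eq h := ⟨1, by rw [IsFractionRing.injective A L h]⟩

variable [IsPrincipalIdealRing R]

theorem IsOrder.algebraMap_trace (hA : IsOrder R A K L) (a : A) :
    algebraMap R K (Algebra.trace R A a) = Algebra.trace K L (algebraMap A L a) := by
  have := hA.finite
  have := hA.torsionFree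
  have := hA.isLocalization
  exact (Algebra.trace_localization R R⁰ a).symm

theorem IsOrder.le_traceDual (hA : IsOrder R A K L) :
    orderSubmodule R A L ≤ traceDual R A K L := by
  rintro _ ⟨a, rfl⟩ _ ⟨b, rfl⟩
  refine Submodule.mem_one.2 ⟨Algebra.trace R A (a * b), ?_⟩
  rw [hA.algebraMap_trace, map_mul]
  rfl

theorem IsOrder.traceDual_fg (hA : IsOrder R A K L) : (traceDual R A K L).FG := by
  have := hA.finiteEtale.finite
  have := hA.isLattice
  exact fg_dualSubmodule hA.finiteEtale.nondegenerate _

theorem IsOrder.dualSubmodule_traceDual (hA : IsOrder R A K L) :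
    (Algebra.traceForm K L).dualSubmodule (traceDual R A K L) = orderSubmodule R A L := by
  have := hA.isLattice
  exact dualSubmodule_dualSubmodule hA.finiteEtale.nondegenerate (Algebra.traceForm_isSymm K) _

theorem IsOrder.trace_mem_one_of_isIntegral (hA : IsOrder R A K L) {x : L}
    (hx : IsIntegral A x) : Algebra.trace K L x ∈ (1 : Submodule R K) := by
  have := hA.finite
  have : Module.Finite A (Algebra.adjoin A {x}) :=
    Module.Finite.iff_fg.2 hx.fg_adjoin_singleton
  have : Module.Finite R (Algebra.adjoin A {x}) := Module.Finite.trans A _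
  have hAx : IsOrder R (Algebra.adjoin A {x}) K L := hA.finiteEtale.isOrder
  exact Submodule.mem_one.2
    ⟨_, hAx.algebraMap_trace ⟨x, Algebra.self_mem_adjoin_singleton A x⟩⟩

theorem IsOrder.subalgebraSubmodule_le_traceDual (hA : IsOrder R A K L) {T : Subalgebra A L}
    (hT : T ≤ integralClosure A L) : subalgebraSubmodule R T ≤ traceDual R A K L :=
  fun _ hx _ hy => hA.trace_mem_one_of_isIntegral
    (hT (T.mul_mem hx (orderSubmodule_le_subalgebraSubmodule T hy)))

theorem IsOrder.subalgebra (hA : IsOrder R A K L) {T : Subalgebra A L}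
    (hT : T ≤ integralClosure A L) : IsOrder R T K L := by
  have : Module.Finite R (traceDual R A K L) := Module.Finite.iff_fg.2 hA.traceDual_fg
  have : IsNoetherian R (traceDual R A K L) := inferInstance
  have : Module.Finite R T := Module.Finite.iff_fg.2 <|
    isNoetherian_submodule.1 this _ (hA.subalgebraSubmodule_le_traceDual hT)
  exact hA.finiteEtale.isOrder

theorem IsOrder.traceAnn_ne_bot (hA : IsOrder R A K L) : traceAnn R A K L ≠ ⊥ := by
  have : Module.Finite R (traceDual R A K L) := Module.Finite.iff_fg.2 hA.traceDual_fg
  have htors : IsTorsion R (TraceQuotient R A K L) := by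
    intro b
    obtain ⟨x, rfl⟩ := Submodule.Quotient.mk_surjective _ b
    obtain ⟨r, hr, hx⟩ := hA.exists_smul_mem (x : L)
    exact ⟨⟨r, mem_nonZeroDivisors_of_ne_zero hr⟩, (Submodule.Quotient.mk_eq_zero _).2 hx⟩
  obtain ⟨r, hr, hr0⟩ := Submodule.annihilator_top_inter_nonZeroDivisors htors
  rw [SetLike.mem_coe, Submodule.annihilator_top] at hr
  exact Submodule.ne_bot_iff _ |>.2 ⟨r, hr, nonZeroDivisors.ne_zero hr0⟩

theorem IsOrder.algebraMap_mem_smul_traceDual_iff (hA : IsOrder R A K L) {p : Ideal R}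
    (hp : p ≠ ⊥) (a : A) :
    algebraMap A L a ∈ p • traceDual R A K L ↔ ∀ b, Algebra.trace R A (a * b) ∈ p := by
  obtain ⟨π, rfl⟩ := (IsPrincipalIdealRing.principal p).principal
  have hπ : algebraMap R K π ≠ 0 := by simpa using hp
  rw [Submodule.ideal_span_singleton_smul]
  constructor
  · rintro ⟨x, hx, hxa : π • x = algebraMap A L a⟩ b
    obtain ⟨r, hr⟩ := Submodule.mem_one.1 (hx _ ⟨b, rfl⟩)
    change algebraMap R K r = Algebra.trace K L (x * algebraMap A L b) at hr
    refine Ideal.mem_span_singleton.2 ⟨r, IsFractionRing.injective R K ?_⟩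
    rw [hA.algebraMap_trace, map_mul (algebraMap A L), map_mul (algebraMap R K), ← hxa,
      smul_mul_assoc, ← algebraMap_smul K π, map_smul, hr, smul_eq_mul]
  · refine fun h => ⟨(algebraMap R K π)⁻¹ • algebraMap A L a, ?_, ?_⟩
    · rintro _ ⟨b, rfl⟩
      obtain ⟨r, hr⟩ := Ideal.mem_span_singleton.1 (h b)
      refine Submodule.mem_one.2 ⟨r, ?_⟩
      change algebraMap R K r =
        Algebra.trace K L ((algebraMap R K π)⁻¹ • algebraMap A L a * algebraMap A L b)
      rw [smul_mul_assoc, map_smul, smul_eq_mul, ← map_mul, ← hA.algebraMap_trace, hr, map_mul,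
        inv_mul_cancel_left₀ hπ]
    · change π • ((algebraMap R K π)⁻¹ • algebraMap A L a) = algebraMap A L a
      rw [← algebraMap_smul K π, smul_inv_smul₀ hπ]

end Orders

section TraceDualModule

variable (R A K L : Type*) [CommRing R] [CommRing A] [Algebra R A]
  [Field K] [Algebra R K] [CommRing L] [Algebra A L]
  [Algebra R L] [IsScalarTower R A L] [Algebra K L] [IsScalarTower R K L]

/-- The trace dual `A^†` as an `A`-submodule of `L`, i.e. as a fractional ideal. The submodule
`traceDual` only carries its `R`-module structure. -/
noncomputable def traceDualModule : Submodule A L where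
  __ := traceDual R A K L
  smul_mem' := by
    rintro a x hx _ ⟨b, rfl⟩
    have h := hx _ ⟨a * b, rfl⟩
    change Algebra.trace K L (x * algebraMap A L (a * b)) ∈ _ at h
    change Algebra.trace K L (a • x * algebraMap A L b) ∈ _
    rwa [Algebra.smul_def, mul_comm (algebraMap A L a), mul_assoc, ← map_mul]

theorem restrictScalars_map_smul_traceDualModule (I : Ideal R) :
    (I.map (algebraMap R A) • traceDualModule R A K L).restrictScalars R =
      I • traceDual R A K L :=
  Ideal.smul_restrictScalars I _

variable {R A K L}

theorem map_smul_traceDualModule_le_one_iff {I : Ideal R} :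
    I.map (algebraMap R A) • traceDualModule R A K L ≤ 1 ↔
      I • traceDual R A K L ≤ orderSubmodule R A L := by
  have hone : orderSubmodule R A L = (1 : Submodule A L).restrictScalars R :=
    Submodule.ext fun _ => Submodule.mem_one.symm
  rw [hone, ← restrictScalars_map_smul_traceDualModule, Submodule.restrictScalars_le]

end TraceDualModule

section Tame

variable {R A : Type*} [CommRing R] [IsLocalRing R] [CommRing A] [Algebra R A]
  [Module.Finite R A] [Module.Free R A]

theorem trace_mem_maximalIdeal_of_mem_radical {a : A}
    (ha : a ∈ ((maximalIdeal R).map (algebraMap R A)).radical) :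
    Algebra.trace R A a ∈ maximalIdeal R := by
  rw [← Ideal.Quotient.eq_zero_iff_mem, ← Algebra.trace_quotient_mk]
  obtain ⟨n, hn⟩ := ha
  refine (Algebra.isNilpotent_trace_of_isNilpotent ⟨n, ?_⟩).eq_zero
  rwa [← map_pow, Ideal.Quotient.eq_zero_iff_mem]

theorem IsTameAt.mem_radical (hA : IsTameAt (maximalIdeal R) A) {a : A}
    (ha : ∀ b, Algebra.trace R A (a * b) ∈ maximalIdeal R) :
    a ∈ ((maximalIdeal R).map (algebraMap R A)).radical := by
  have hnil : IsNilpotent (Ideal.Quotient.mk ((maximalIdeal R).map (algebraMap R A)) a) := by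
    refine (hA _).1 fun y => ?_
    obtain ⟨b, rfl⟩ := Ideal.Quotient.mk_surjective y
    rw [← map_mul, Algebra.trace_quotient_mk, Ideal.Quotient.eq_zero_iff_mem]
    exact ha b
  obtain ⟨n, hn⟩ := hnil
  exact ⟨n, by rwa [← map_pow, Ideal.Quotient.eq_zero_iff_mem] at hn⟩

end Tame

section TameOrders

variable {R A O K L : Type*} [CommRing R] [IsDomain R] [IsDiscreteValuationRing R]
  [CommRing A] [Algebra R A] [CommRing O] [Algebra R O]
  [Field K] [Algebra R K] [IsFractionRing R K] [CommRing L]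
  [Algebra A L] [IsFractionRing A L] [Algebra O L] [IsFractionRing O L]
  [Algebra R L] [IsScalarTower R A L] [IsScalarTower R O L] [Algebra K L] [IsScalarTower R K L]

theorem IsOrder.exists_maximalIdeal_pow_smul_traceDual_le (hA : IsOrder R A K L) :
    ∃ k : ℕ, maximalIdeal R ^ k • traceDual R A K L ≤ orderSubmodule R A L := by
  obtain ⟨k, hk⟩ := exists_maximalIdeal_pow_eq_of_principal R
    (IsPrincipalIdealRing.principal _) _ hA.traceAnn_ne_bot
  exact ⟨k, Submodule.smul_le.2 fun r hr x hx => smul_mem_order (hk ▸ hr) ⟨x, hx⟩⟩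

theorem IsOrder.smul_traceDual_le_of_isTameAt [IsIntegrallyClosedIn O L] (hO : IsOrder R O K L)
    (htame : IsTameAt (maximalIdeal R) O) :
    maximalIdeal R • traceDual R O K L ≤ orderSubmodule R O L := by
  have := hO.finite
  have := hO.torsionFree
  have : IsNoetherianRing O := IsNoetherianRing.of_finite R O
  let p : Ideal O := (maximalIdeal R).map (algebraMap R O)
  have hunit : ∃ u ∈ p.radical, IsUnit (algebraMap O L u) := by
    obtain ⟨π, hπ⟩ := IsDiscreteValuationRing.exists_irreducible R
    have hπp : π ∈ maximalIdeal R := hπ.maximalIdeal_eq ▸ Ideal.mem_span_singleton_self π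
    have := hO.isLocalization
    exact ⟨algebraMap R O π, Ideal.le_radical (Ideal.mem_map_of_mem _ hπp),
      IsLocalization.map_units L (M := Algebra.algebraMapSubmonoid O R⁰)
        ⟨_, π, mem_nonZeroDivisors_of_ne_zero hπ.ne_zero, rfl⟩⟩
  have hrad : (p • traceDualModule R O K L).comap (Algebra.linearMap O L) ≤ p.radical := by
    intro a ha
    have ha' : algebraMap O L a ∈ maximalIdeal R • traceDual R O K L := by
      rw [← restrictScalars_map_smul_traceDualModule]
      exact ha
    exact htame.mem_radical <| (hO.algebraMap_mem_smul_traceDual_iff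
      (IsDiscreteValuationRing.not_a_field R) a).1 ha'
  have hpow : ∃ m, p.radical ^ m • p • traceDualModule R O K L ≤ 1 := by
    obtain ⟨n, hn⟩ := p.exists_radical_pow_le_of_fg (IsNoetherian.noetherian _)
    obtain ⟨k, hk⟩ := hO.exists_maximalIdeal_pow_smul_traceDual_le
    rw [← map_smul_traceDualModule_le_one_iff, Ideal.map_pow] at hk
    refine ⟨n * k, le_trans ?_ hk⟩
    rw [pow_mul]
    exact Submodule.smul_mono (Ideal.pow_right_mono hn k) Submodule.smul_le_right
  obtain ⟨m, hm⟩ := hpow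
  exact map_smul_traceDualModule_le_one_iff.1
    (le_one_of_pow_smul_le_one (IsNoetherian.noetherian _) hunit hrad hm)

variable [Algebra A O] [IsScalarTower R A O] [IsScalarTower A O L]

theorem IsOrder.traceDual_le_traceDual_of_isTameAt (hA : IsOrder R A K L) (hO : IsOrder R O K L)
    (htame : IsTameAt (maximalIdeal R) A)
    (h : maximalIdeal R • traceDual R A K L ≤ orderSubmodule R A L) :
    traceDual R A K L ≤ traceDual R O K L := by
  have := hA.finite
  have := hA.torsionFree
  have := hO.finite
  have := hO.torsionFree
  have : IsTorsionFree R L := .trans_faithfulSMul R K L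
  have hp : maximalIdeal R ≠ ⊥ := IsDiscreteValuationRing.not_a_field R
  refine le_of_ideal_smul_le_smul hp fun x hx => ?_
  obtain ⟨a, rfl⟩ := h hx
  have ha : a ∈ ((maximalIdeal R).map (algebraMap R A)).radical :=
    htame.mem_radical ((hA.algebraMap_mem_smul_traceDual_iff hp a).1 hx)
  have haO : algebraMap A O a ∈ ((maximalIdeal R).map (algebraMap R O)).radical := by
    have := Ideal.map_radical_le (algebraMap A O) (Ideal.mem_map_of_mem _ ha)
    rwa [Ideal.map_map, ← IsScalarTower.algebraMap_eq] at this
  change algebraMap A L a ∈ _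
  rw [IsScalarTower.algebraMap_apply A O L]
  exact (hO.algebraMap_mem_smul_traceDual_iff hp _).2 fun b =>
    trace_mem_maximalIdeal_of_mem_radical (Ideal.mul_mem_right b _ haO)

theorem IsOrder.orderSubmodule_le_of_isTameAt (hA : IsOrder R A K L) (hO : IsOrder R O K L)
    (htame : IsTameAt (maximalIdeal R) A)
    (h : maximalIdeal R • traceDual R A K L ≤ orderSubmodule R A L) :
    orderSubmodule R O L ≤ orderSubmodule R A L := by
  rw [← hA.dualSubmodule_traceDual, le_dualSubmodule_comm (Algebra.traceForm_isSymm K)]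
  exact hA.traceDual_le_traceDual_of_isTameAt hO htame h

theorem IsOrder.isIntegrallyClosedIn_of_isTameAt (hA : IsOrder R A K L)
    (htame : IsTameAt (maximalIdeal R) A)
    (h : maximalIdeal R • traceDual R A K L ≤ orderSubmodule R A L) :
    IsIntegrallyClosedIn A L := by
  refine isIntegrallyClosedIn_iff.2 ⟨IsFractionRing.injective A L, fun {x} hx => ?_⟩
  have hO := hA.subalgebra (le_refl (integralClosure A L))
  exact hA.orderSubmodule_le_of_isTameAt hO htame h ⟨⟨x, hx⟩, rfl⟩

end TameOrders

section Quotient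

variable {R A K L : Type*} [CommRing R] [CommRing A] [Algebra R A]
  [Field K] [Algebra R K] [CommRing L] [Algebra A L]
  [Algebra R L] [IsScalarTower R A L] [Algebra K L] [IsScalarTower R K L]
  {P Q : Submodule R L}

theorem mk_mem_quotientSubmodule_iff (hP : orderSubmodule R A L ≤ P)
    (x : traceDual R A K L) :
    Submodule.Quotient.mk x ∈ quotientSubmodule A K P ↔ (x : L) ∈ P := by
  refine ⟨?_, fun h => ⟨x, h, rfl⟩⟩
  rintro ⟨y, hy, hxy⟩
  have h : ((x - y : traceDual R A K L) : L) ∈ orderSubmodule R A L :=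
    (Submodule.Quotient.eq
      ((orderSubmodule R A L).submoduleOf (traceDual R A K L))).1 hxy.symm
  simpa using add_mem (hP h) hy

theorem quotientSubmodule_le_iff (hP : P ≤ traceDual R A K L) (hQ : orderSubmodule R A L ≤ Q) :
    quotientSubmodule A K P ≤ quotientSubmodule A K Q ↔ P ≤ Q := by
  constructor
  · exact fun h x hx =>
      (mk_mem_quotientSubmodule_iff hQ ⟨x, hP hx⟩).1 (h ⟨⟨x, hP hx⟩, hx, rfl⟩)
  · rintro h _ ⟨x, hx, rfl⟩
    exact ⟨x, h hx, rfl⟩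

theorem traceQuotientForm_mk_eq_zero_iff (x y : traceDual R A K L) :
    traceQuotientForm R A K L (Submodule.Quotient.mk x) (Submodule.Quotient.mk y) = 0 ↔
      Algebra.trace K L ((x : L) * y) ∈ (1 : Submodule R K) := by
  rw [traceQuotientForm_mk, Submodule.Quotient.mk_eq_zero]
  rfl

theorem orthogonalBilin_quotientSubmodule (hP : P ≤ traceDual R A K L) :
    (quotientSubmodule A K P).orthogonalBilin (traceQuotientForm R A K L) =
      quotientSubmodule A K ((Algebra.traceForm K L).dualSubmodule P) := by
  apply le_antisymm
  · intro b hb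
    obtain ⟨x, rfl⟩ := Submodule.Quotient.mk_surjective _ b
    refine ⟨x, fun y hy => ?_, rfl⟩
    rw [Algebra.traceForm_apply, mul_comm]
    exact (traceQuotientForm_mk_eq_zero_iff ⟨y, hP hy⟩ x).1 (hb _ ⟨⟨y, hP hy⟩, hy, rfl⟩)
  · rintro _ ⟨x, hx, rfl⟩ _ ⟨y, hy, rfl⟩
    refine (traceQuotientForm_mk_eq_zero_iff y x).2 ?_
    rw [mul_comm]
    exact hx y hy

theorem map_smul_quotientSubmodule (I : Ideal R) (hP : P ≤ traceDual R A K L) :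
    I.map (Ideal.Quotient.mk (traceAnn R A K L)) • quotientSubmodule A K P =
      quotientSubmodule A K (I • P) := by
  apply le_antisymm
  · refine Submodule.smul_le.2 ?_
    rintro c hc _ ⟨x, hx, rfl⟩
    obtain ⟨r, hr, rfl⟩ :=
      (Ideal.mem_map_iff_of_surjective _ Ideal.Quotient.mk_surjective).1 hc
    exact ⟨r • x, Submodule.smul_mem_smul hr hx, rfl⟩
  · rintro _ ⟨⟨x, hx⟩, hxP, rfl⟩
    change x ∈ I • P at hxP
    induction hxP using Submodule.smul_induction_on' with
    | smul r hr y hy =>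
      exact Submodule.smul_mem_smul (N := quotientSubmodule A K P) (Ideal.mem_map_of_mem _ hr)
        ⟨⟨y, hP hy⟩, hy, rfl⟩
    | add y hy z hz ihy ihz =>
      exact add_mem (ihy (hP (Submodule.smul_le_right hy))) (ihz (hP (Submodule.smul_le_right hz)))

theorem map_smul_orthogonalBilin_quotientSubmodule_le_iff (I : Ideal R)
    (hAP : orderSubmodule R A L ≤ P) (hP : P ≤ traceDual R A K L) :
    I.map (Ideal.Quotient.mk (traceAnn R A K L)) •
        (quotientSubmodule A K P).orthogonalBilin (traceQuotientForm R A K L) ≤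
          quotientSubmodule A K P ↔
      I • (Algebra.traceForm K L).dualSubmodule P ≤ P := by
  have hdual : (Algebra.traceForm K L).dualSubmodule P ≤ traceDual R A K L :=
    dualSubmodule_anti hAP
  rw [orthogonalBilin_quotientSubmodule hP, map_smul_quotientSubmodule I hdual,
    quotientSubmodule_le_iff (Submodule.smul_le_right.trans hdual) hAP]

theorem isRootSubmodule_quotientSubmodule_iff (I : Ideal R)
    (hAP : orderSubmodule R A L ≤ P) (hP : P ≤ traceDual R A K L) :
    IsRootSubmodule (I.map (Ideal.Quotient.mk (traceAnn R A K L))) (traceQuotientForm R A K L)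
        (quotientSubmodule A K P) ↔
      I • (Algebra.traceForm K L).dualSubmodule P ≤ P ∧
        P ≤ (Algebra.traceForm K L).dualSubmodule P := by
  unfold IsRootSubmodule
  rw [map_smul_orthogonalBilin_quotientSubmodule_le_iff I hAP hP,
    orthogonalBilin_quotientSubmodule hP, quotientSubmodule_le_iff hP
      ((le_dualSubmodule_comm (Algebra.traceForm_isSymm K)).1 hP)]

end Quotient

section IntegralClosure

variable {R A K L : Type*} [CommRing R] [IsDomain R] [IsDiscreteValuationRing R]
  [CommRing A] [Algebra R A] [Field K] [Algebra R K] [IsFractionRing R K]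
  [CommRing L] [Algebra A L] [IsFractionRing A L]
  [Algebra R L] [IsScalarTower R A L] [Algebra K L] [IsScalarTower R K L]

theorem IsOrder.isRootSubmodule_integralClosure (hA : IsOrder R A K L)
    (htame : IsTameAt (maximalIdeal R) (integralClosure A L)) :
    IsRootSubmodule ((maximalIdeal R).map (Ideal.Quotient.mk (traceAnn R A K L)))
      (traceQuotientForm R A K L)
      (quotientSubmodule A K (subalgebraSubmodule R (integralClosure A L))) := by
  have hO := hA.subalgebra (le_refl (integralClosure A L))
  rw [isRootSubmodule_quotientSubmodule_iff _ (orderSubmodule_le_subalgebraSubmodule _)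
    (hA.subalgebraSubmodule_le_traceDual le_rfl), ← orderSubmodule_subalgebra]
  exact ⟨hO.smul_traceDual_le_of_isTameAt htame, hO.le_traceDual⟩

theorem IsOrder.integralClosure_le_of_isTameAt (hA : IsOrder R A K L) {T : Subalgebra A L}
    (hT : T ≤ integralClosure A L) (htame : IsTameAt (maximalIdeal R) T)
    (h : maximalIdeal R • (Algebra.traceForm K L).dualSubmodule (subalgebraSubmodule R T) ≤
      subalgebraSubmodule R T) :
    integralClosure A L ≤ T := by
  rw [← orderSubmodule_subalgebra] at h
  have := (hA.subalgebra hT).isIntegrallyClosedIn_of_isTameAt htame h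
  intro x hx
  obtain ⟨t, rfl⟩ := IsIntegrallyClosedIn.algebraMap_eq_of_integral (hx.tower_top (A := T))
  exact t.2

end IntegralClosure

end TraceOrder

open TraceOrder in
theorem mainTheorem5
    {R A K L : Type*} [CommRing R] [IsDomain R] [IsDiscreteValuationRing R]
    [CommRing A] [Algebra R A]
    [Field K] [Algebra R K] [IsFractionRing R K]
    [CommRing L] [Algebra A L] [IsFractionRing A L]
    [Algebra R L] [IsScalarTower R A L] [Algebra K L] [IsScalarTower R K L]
    (hA : IsOrder R A K L)
    (htame : IsTameAt (IsLocalRing.maximalIdeal R) (integralClosure A L))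
    (𝔪 : Ideal (R ⧸ traceAnn R A K L))
    (h𝔪 : 𝔪 = (IsLocalRing.maximalIdeal R).map (Ideal.Quotient.mk (traceAnn R A K L)))
    (D : Submodule R L) (hAD : orderSubmodule R A L ≤ D) (hDA : D ≤ traceDual R A K L)
    (hD : quotientSubmodule A K D = radicalRoot 𝔪 (traceQuotientForm R A K L)) :
    (subalgebraSubmodule R (integralClosure A L) ≤ traceDual R A K L ∧
      Algebra.adjoin A (D : Set L) ≤ integralClosure A L ∧
      radicalRoot 𝔪 (traceQuotientForm R A K L) ≤
        quotientSubmodule A K (subalgebraSubmodule R (Algebra.adjoin A (D : Set L))) ∧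
      quotientSubmodule A K (subalgebraSubmodule R (Algebra.adjoin A (D : Set L))) ≤
        quotientSubmodule A K (subalgebraSubmodule R (integralClosure A L))) ∧
    (IsAnisotropic 𝔪 (traceQuotientForm R A K L) →
      quotientSubmodule A K (subalgebraSubmodule R (integralClosure A L)) =
        lowerRoot (TraceQuotient R A K L) 𝔪) ∧
    (𝔪 • (radicalRoot 𝔪 (traceQuotientForm R A K L)).orthogonalBilin
          (traceQuotientForm R A K L) ≤
        radicalRoot 𝔪 (traceQuotientForm R A K L) →
      IsTameAt (IsLocalRing.maximalIdeal R) (Algebra.adjoin A (D : Set L)) →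
      quotientSubmodule A K (subalgebraSubmodule R (integralClosure A L)) =
          quotientSubmodule A K (subalgebraSubmodule R (Algebra.adjoin A (D : Set L))) ∧
        integralClosure A L = Algebra.adjoin A (D : Set L)) := by
  subst h𝔪
  have hO := hA.subalgebraSubmodule_le_traceDual (le_refl (integralClosure A L))
  have hroot := hA.isRootSubmodule_integralClosure htame
  have hDO : D ≤ subalgebraSubmodule R (integralClosure A L) := by
    rw [← quotientSubmodule_le_iff hDA (orderSubmodule_le_subalgebraSubmodule _), hD]
    exact sInf_le hroot
  have hT : Algebra.adjoin A (D : Set L) ≤ integralClosure A L := Algebra.adjoin_le hDO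
  have hDT : D ≤ subalgebraSubmodule R (Algebra.adjoin A (D : Set L)) := Algebra.subset_adjoin
  refine ⟨⟨hO, hT, ?_, ?_⟩, fun h => (h _).1 hroot, fun h hTtame => ?_⟩
  · rw [← hD]
    exact (quotientSubmodule_le_iff hDA (orderSubmodule_le_subalgebraSubmodule _)).2 hDT
  · exact (quotientSubmodule_le_iff (hA.subalgebraSubmodule_le_traceDual hT)
      (orderSubmodule_le_subalgebraSubmodule _)).2 hT
  · rw [← hD, map_smul_orthogonalBilin_quotientSubmodule_le_iff _ hAD hDA] at h
    have heq : integralClosure A L = Algebra.adjoin A (D : Set L) :=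
      le_antisymm (hA.integralClosure_le_of_isTameAt hT hTtame
        ((Submodule.smul_mono le_rfl (dualSubmodule_anti hDT)).trans (h.trans hDT))) hT
    exact ⟨by rw [← heq], heq⟩
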